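/- Let $n\ge 0$ be an integer and let $f:\mathrm{GL}_n(\mathbb{C})\to\mathbb{C}$ be a regular function, i.e. $f(A)=\det(A)^N p(A)$ for some $N\in\mathbb{Z}$ and some polynomial $p$ in the matrix entries. For $A\in \mathrm{GL}_n(\mathbb{C})$ let $\mathrm{sLog}(A)\in\mathbb{R}^n/\mathcal{S}_n$ be the tuple of logarithms of the singular values of $A$, up to permutation of the coordinates. Let the matrix amoeba $\mathrm{s}\mathcal{A}(f)$ be the image under $\mathrm{sLog}$ of the zero set of $f$, regarded as a permutation-invariant subset of $\mathbb{R}^n$, and let $\Gamma$ be the set of connected components of its complement $\mathbb{R}^n\setminus \mathrm{s}\mathcal{A}(f)$. Let $\mu$ be the Haar probability measure on the unitary group $\mathrm{U}(n)$, and let $$R_f(x)=\int_{\mathrm{U}(n)}\int_{\mathrm{U}(n)}\ln\left|f\big(U\exp(\mathrm{diag}(x))V^*\big)\right|\,d\mu(U)\,d\mu(V)\in\mathbb{R}\cup\{-\infty\}\qquad(x\in\mathbb{R}^n)$$ be the Ronkin function of $f$, where $\ln 0=-\infty$. Then for every $C\in\Gamma$ the function $R_f$ is finite and differentiable at every point of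 $C$, and its gradient is the same vector at all points of $C$; this vector, denoted $\nu_f(C)$, lies in $\mathbb{Z}^n$. The order map $\nu_f:\Gamma\to\mathbb{Z}^n$ so defined is injective: if $C_1,C_2\in\Gamma$ and $\nu_f(C_1)=\nu_f(C_2)$, then $C_1=C_2$. -/

import Mathlib

open scoped ENNReal

noncomputable section

namespace MatrixAmoeba

/-- A function on `GL_n(ℂ)` is regular if it has the form `A ↦ det(A)^N * p(A)` with `N ∈ ℤ` and
`p` a polynomial in the matrix entries. -/
def IsRegular {n : ℕ} (f : GL (Fin n) ℂ → ℂ) : Prop :=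
  ∃ (N : ℤ) (p : MvPolynomial (Fin n × Fin n) ℂ), ∀ A : GL (Fin n) ℂ,
    f A = (A : Matrix (Fin n) (Fin n) ℂ).det ^ N *
      MvPolynomial.eval (fun ij => (A : Matrix (Fin n) (Fin n) ℂ) ij.1 ij.2) p

/-- Two vectors of `ℝⁿ` are identified if they differ by a permutation of the coordinates. -/
def permSetoid (n : ℕ) : Setoid (EuclideanSpace ℝ (Fin n)) where
  r x y := ∃ σ : Equiv.Perm (Fin n), ∀ i, y i = x (σ i)
  iseqv :=
    { refl := fun _ => ⟨1, fun _ => rfl⟩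
      symm := by
        rintro x y ⟨σ, h⟩
        exact ⟨σ⁻¹, fun i => by simp [h]⟩
      trans := by
        rintro x y z ⟨σ, h⟩ ⟨τ, k⟩
        exact ⟨σ * τ, fun i => by simp [h, k]⟩ }

/-- The matrix logarithm `GL_n(ℂ) → ℝⁿ / 𝒮ₙ`: the logarithms of the singular values. -/
def sLog {n : ℕ} (A : GL (Fin n) ℂ) : Quotient (permSetoid n) :=
  Quotient.mk (permSetoid n) (WithLp.toLp 2 fun i : Fin n =>
    Real.log ((Matrix.toEuclideanLin (A : Matrix (Fin n) (Fin n) ℂ)).singularValues i))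

/-- The matrix amoeba of the hypersurface `f = 0`, that is, the image of the zero set of `f` under
`sLog`, regarded as a permutation-invariant subset of `ℝⁿ`. -/
def matrixAmoeba {n : ℕ} (f : GL (Fin n) ℂ → ℂ) : Set (EuclideanSpace ℝ (Fin n)) :=
  Quotient.mk (permSetoid n) ⁻¹' (sLog '' {A | f A = 0})

/-- The connected components of the complement of the matrix amoeba. -/
def complementComponents {n : ℕ} (f : GL (Fin n) ℂ → ℂ) : Set (Set (EuclideanSpace ℝ (Fin n))) :=
  {C | ∃ x ∈ (matrixAmoeba f)ᶜ, C = connectedComponentIn (matrixAmoeba f)ᶜ x}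

theorem complementComponents_nonempty {n : ℕ} {f : GL (Fin n) ℂ → ℂ}
    (C : complementComponents f) : (C : Set (EuclideanSpace ℝ (Fin n))).Nonempty := by
  obtain ⟨C, x, hx, rfl⟩ := C
  exact ⟨x, mem_connectedComponentIn hx⟩

instance instCompactSpaceUnitaryGroup (n : ℕ) : CompactSpace (Matrix.unitaryGroup (Fin n) ℂ) := by
  have hK : IsCompact (Set.univ.pi fun _ : Fin n => Set.univ.pi fun _ : Fin n =>
      Metric.closedBall (0 : ℂ) 1) :=
    isCompact_univ_pi fun _ => isCompact_univ_pi fun _ => isCompact_closedBall 0 1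
  have h : IsCompact (Matrix.unitaryGroup (Fin n) ℂ : Set (Matrix (Fin n) (Fin n) ℂ)) := by
    refine IsCompact.of_isClosed_subset hK isClosed_unitary ?_
    intro U hU i _ j _
    simpa using entry_norm_bound_of_unitary hU i j
  exact isCompact_iff_compactSpace.mp h

instance instMeasurableSpaceUnitaryGroup (n : ℕ) :
    MeasurableSpace (Matrix.unitaryGroup (Fin n) ℂ) := borel _

instance instBorelSpaceUnitaryGroup (n : ℕ) : BorelSpace (Matrix.unitaryGroup (Fin n) ℂ) := ⟨rfl⟩

/-- The Haar probability measure on the unitary group. -/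
def unitaryHaar (n : ℕ) : MeasureTheory.Measure (Matrix.unitaryGroup (Fin n) ℂ) :=
  MeasureTheory.Measure.haarMeasure ⊤

/-- The integral of an extended-real-valued function: the integral of the positive part minus the
integral of the negative part. -/
def extIntegral {α : Type*} [MeasurableSpace α] (μ : MeasureTheory.Measure α) (g : α → EReal) :
    EReal :=
  ((∫⁻ a, (g a).toENNReal ∂μ : ℝ≥0∞) : EReal) - ((∫⁻ a, (-g a).toENNReal ∂μ : ℝ≥0∞) : EReal)

/-- The invertible matrix `exp(diag(x))`. -/
def expDiag {n : ℕ} (x : EuclideanSpace ℝ (Fin n)) : GL (Fin n) ℂ where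
  val := Matrix.diagonal fun i => ((Real.exp (x i) : ℝ) : ℂ)
  inv := Matrix.diagonal fun i => ((Real.exp (-x i) : ℝ) : ℂ)
  val_inv := by
    rw [Matrix.diagonal_mul_diagonal, ← Matrix.diagonal_one]
    congr 1
    ext i
    rw [← Complex.ofReal_mul, ← Real.exp_add]
    simp
  inv_val := by
    rw [Matrix.diagonal_mul_diagonal, ← Matrix.diagonal_one]
    congr 1
    ext i
    rw [← Complex.ofReal_mul, ← Real.exp_add]
    simp

/-- The Ronkin function `R_f(x) = ∫∫ ln |f(U exp(diag(x)) V*)| dμ(U) dμ(V)`, with `ln 0 = -∞`. -/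
def ronkin {n : ℕ} (f : GL (Fin n) ℂ → ℂ) (x : EuclideanSpace ℝ (Fin n)) : EReal :=
  extIntegral ((unitaryHaar n).prod (unitaryHaar n)) fun p =>
    ENNReal.log ‖f (Unitary.toUnits p.1 * expDiag x * Unitary.toUnits (star p.2))‖ₑ

/-- The order map: the gradient of the Ronkin function at some point of the component. -/
def orderMap {n : ℕ} (f : GL (Fin n) ℂ → ℂ) (C : complementComponents f) :
    EuclideanSpace ℝ (Fin n) :=
  gradient (fun y => (ronkin f y).toReal) (complementComponents_nonempty C).some

end MatrixAmoeba

end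

/-!
The theorem is reduced to one complex variable. By the singular value decomposition
(`sLog_eq_mk_iff`), a point `x` lies outside the matrix amoeba exactly if `f` does not vanish at any
`U * exp(diag x) * V*` with `U`, `V` unitary (`notMem_matrixAmoeba_iff`); as the unitary group is
compact, the complement of the amoeba is open.

For an integer vector `k`, restricting `f` to `t ↦ U * exp(diag x) * diag(t^k) * V*` gives a Laurent
polynomial in `t`. The argument of `t` can be absorbed into `U`, so this restriction has no zero on
the circle `|t| = exp s` for any `U`, `V` exactly if `x + s • k` is outside the amoeba. By Jensen's
formula the mean of its `log ‖·‖` over such circles is affine in `s` on zero-free annuli, and its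
slope is the number of zeros in the disc minus the order of the pole at the origin; equal slopes at
both ends of an annulus therefore exclude zeros in between (`IsLaurent.exists_slope`).

Right invariance of Haar measure makes the Ronkin function the average over `(U, V)` of these circle
means (`ronkin_eq_integral_orbitMean`). On a component `C` of the complement the slope is an integer
depending continuously on `(x, U, V)` in `C × U(n) × U(n)`, which is connected, so it is constant
(`exists_orbitMean_slope`). Taking the coordinate vectors for `k` shows that the Ronkin function is
locally affine on `C` with a fixed integer gradient `m` (`exists_ronkin_affine`), and the slope in a
general direction `k` is then `∑ i, m i * k i` (`orbitMean_slope_eq_sum`).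

For injectivity, components being open, two of them contain points that differ by a positive
multiple of an integer vector `k`. If the gradients agree, then so do the slopes in direction `k` at
both ends of the segment between these points, for all `U`, `V`. Hence no zero occurs along the
segment, which stays in the complement of the amoeba, and the two components are the same
(`eq_of_gradient_eq`).
-/

noncomputable section

namespace MatrixAmoeba

open MeasureTheory

/-! ### Singular value decomposition -/

theorem exists_perm_of_map_univ_eq {ι α : Type*} [Fintype ι] {f g : ι → α}
    (h : Finset.univ.val.map f = Finset.univ.val.map g) :
    ∃ σ : Equiv.Perm ι, ∀ i, g i = f (σ i) := by
  classical
  -- corresponding fibres of `g` and `f` have the same cardinality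
  have key : ∀ a, Nonempty ({i // g i = a} ≃ {i // f i = a}) := fun a => by
    refine ⟨Fintype.equivOfCardEq ?_⟩
    have := congrArg (Multiset.count a) h
    rw [Multiset.count_map, Multiset.count_map] at this
    rw [Fintype.card_subtype, Fintype.card_subtype]
    simpa [Finset.card_def, eq_comm] using this.symm
  let e := fun a => Classical.choice (key a)
  refine ⟨(Equiv.sigmaFiberEquiv g).symm.trans ((Equiv.sigmaCongrRight e).trans
    (Equiv.sigmaFiberEquiv f)), fun i => ?_⟩
  exact (e (g i) ⟨i, rfl⟩).2.symm

/-- The squared singular values are the eigenvalues of `Aᴴ * A`. -/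
theorem roots_charpoly_conjTranspose_mul_self {n : ℕ} (A : Matrix (Fin n) (Fin n) ℂ) :
    (A.conjTranspose * A).charpoly.roots = Finset.univ.val.map fun i : Fin n =>
      (((Matrix.toEuclideanLin A).singularValues i ^ 2 : ℝ) : ℂ) := by
  set T := Matrix.toEuclideanLin A with hT
  have h1 : LinearMap.adjoint T ∘ₗ T = Matrix.toEuclideanLin (A.conjTranspose * A) := by
    rw [hT, ← Matrix.toEuclideanLin_conjTranspose_eq_adjoint]
    ext v i
    simp [Matrix.toLpLin_apply, Matrix.mulVec_mulVec]
  have h2 : (Matrix.toEuclideanLin (A.conjTranspose * A)).charpoly =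
      (A.conjTranspose * A).charpoly := by
    rw [Matrix.toEuclideanLin_eq_toLin_orthonormal]
    exact Matrix.charpoly_toLin _ _
  rw [← h2, ← h1, T.isSymmetric_adjoint_comp_self.roots_charpoly_eq_eigenvalues
      finrank_euclideanSpace_fin]
  refine Multiset.map_congr rfl fun i _ => ?_
  rw [LinearMap.sq_singularValues_fin T finrank_euclideanSpace_fin i, Function.comp_apply]
  generalize T.isSymmetric_adjoint_comp_self.eigenvalues finrank_euclideanSpace_fin i = r
  rfl

theorem singularValues_pos {n : ℕ} (A : GL (Fin n) ℂ) (i : Fin n) :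
    0 < (Matrix.toEuclideanLin (A : Matrix (Fin n) (Fin n) ℂ)).singularValues i := by
  refine (LinearMap.injective_iff_forall_lt_finrank_singularValues_pos _).1 ?_ i (by simp)
  intro v w h
  have : Matrix.mulVec (A : Matrix (Fin n) (Fin n) ℂ) v.ofLp = Matrix.mulVec A.1 w.ofLp :=
    congrArg WithLp.ofLp h
  have h2 := congrArg (Matrix.mulVec (A⁻¹ : GL (Fin n) ℂ).1) this
  rw [Matrix.mulVec_mulVec, Matrix.mulVec_mulVec, ← Units.val_mul, inv_mul_cancel] at h2
  exact WithLp.ofLp_injective 2 (by simpa using h2)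

theorem sLog_eq_mk_iff_roots {n : ℕ} (A : GL (Fin n) ℂ) (x : EuclideanSpace ℝ (Fin n)) :
    sLog A = Quotient.mk (permSetoid n) x ↔
      (A.1.conjTranspose * A.1).charpoly.roots =
        Finset.univ.val.map fun i => ((Real.exp (x i) ^ 2 : ℝ) : ℂ) := by
  rw [sLog, Quotient.eq, roots_charpoly_conjTranspose_mul_self]
  constructor
  · rintro ⟨σ, h⟩
    have : (fun i => ((Real.exp (x i) ^ 2 : ℝ) : ℂ)) =
        (fun i : Fin n => (((Matrix.toEuclideanLin A.1).singularValues i ^ 2 : ℝ) : ℂ)) ∘ σ := by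
      ext i
      simp [h, Real.exp_log (singularValues_pos A _)]
    rw [this, ← Multiset.map_map]
    congr 1
    simp
  · intro h
    obtain ⟨σ, h⟩ := exists_perm_of_map_univ_eq h
    refine ⟨σ, fun i => ?_⟩
    have h1 := h i
    rw [Complex.ofReal_inj, sq_eq_sq₀ (Real.exp_pos _).le (singularValues_pos A _).le] at h1
    simp [← h1]

/-- The singular value decomposition: `sLog A` is the class of `x` exactly if `A` is
`U * exp(diag x) * V*` for unitary `U`, `V`. -/
theorem sLog_eq_mk_iff {n : ℕ} (A : GL (Fin n) ℂ) (x : EuclideanSpace ℝ (Fin n)) :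
    sLog A = Quotient.mk (permSetoid n) x ↔
      ∃ U V : Matrix.unitaryGroup (Fin n) ℂ,
        A = Unitary.toUnits U * expDiag x * Unitary.toUnits (star V) := by
  rw [sLog_eq_mk_iff_roots]
  have hD : (expDiag x).1.conjTranspose = (expDiag x).1 := by
    simp [expDiag, Matrix.diagonal_conjTranspose, Pi.star_def, -Complex.ofReal_exp]
  have hD2 : (expDiag x).1 * (expDiag x).1
      = Matrix.diagonal fun i => ((Real.exp (x i) ^ 2 : ℝ) : ℂ) := by
    simp [expDiag, Matrix.diagonal_mul_diagonal, sq]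
  constructor
  · intro h
    have hB := Matrix.isHermitian_conjTranspose_mul_self A.1
    rw [hB.roots_charpoly_eq_eigenvalues] at h
    obtain ⟨σ, h⟩ := exists_perm_of_map_univ_eq h
    set W : Matrix (Fin n) (Fin n) ℂ := hB.eigenvectorUnitary.1 with hW
    have hWW : star W * W = 1 := Unitary.coe_star_mul_self _
    -- reorder the eigenvectors so that the eigenvalues appear in the order given by `x`
    let V : Matrix.unitaryGroup (Fin n) ℂ := ⟨W.submatrix id σ, by
      rw [Matrix.mem_unitaryGroup_iff', Matrix.star_eq_conjTranspose,
        Matrix.conjTranspose_submatrix, ← Matrix.submatrix_mul _ _ _ _ _ Function.bijective_id, ← Matrix.star_eq_conjTranspose, hWW]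
      simp⟩
    have hV : star V.1 * V.1 = 1 := Unitary.coe_star_mul_self _
    have hV' : V.1 * star V.1 = 1 := Unitary.coe_mul_star_self _
    have hB' : A.1.conjTranspose * A.1 = V.1 * ((expDiag x).1 * (expDiag x).1) * star V.1 := by
      have h1 := hB.spectral_theorem
      rw [Unitary.conjStarAlgAut_apply] at h1
      rw [hD2]
      have h2 : (Matrix.diagonal fun i => ((Real.exp (x i) ^ 2 : ℝ) : ℂ)) =
          (Matrix.diagonal (RCLike.ofReal ∘ hB.eigenvalues)).submatrix σ σ := by
        rw [Matrix.submatrix_diagonal_equiv]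
        exact congrArg _ (funext h)
      rw [h2, Matrix.star_eq_conjTranspose, Matrix.conjTranspose_submatrix,
        Matrix.submatrix_mul_equiv, Matrix.submatrix_mul_equiv, Matrix.submatrix_id_id]
      exact h1
    have hE : (expDiag x).1 * (expDiag x)⁻¹.1 = 1 := Units.mul_inv _
    have hE' : (expDiag x)⁻¹.1 * (expDiag x).1 = 1 := Units.inv_mul _
    have hEi : (expDiag x)⁻¹.1.conjTranspose = (expDiag x)⁻¹.1 := by
      change (expDiag x).inv.conjTranspose = (expDiag x).inv
      simp [expDiag, Matrix.diagonal_conjTranspose, Pi.star_def, -Complex.ofReal_exp]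
    -- the second unitary factor is forced to be `A * V * exp(-diag x)`
    let U : Matrix.unitaryGroup (Fin n) ℂ := ⟨A.1 * V.1 * (expDiag x)⁻¹.1, by
      rw [Matrix.mem_unitaryGroup_iff', Matrix.star_eq_conjTranspose, Matrix.conjTranspose_mul,
        Matrix.conjTranspose_mul, hEi]
      calc _ = (expDiag x)⁻¹.1 * (V.1.conjTranspose * (A.1.conjTranspose * A.1) * V.1) *
            (expDiag x)⁻¹.1 := by simp only [mul_assoc]
        _ = (expDiag x)⁻¹.1 * ((star V.1 * V.1) * ((expDiag x).1 * (expDiag x).1) *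
            (star V.1 * V.1)) * (expDiag x)⁻¹.1 := by
          rw [hB', Matrix.star_eq_conjTranspose]; simp only [mul_assoc]
        _ = ((expDiag x)⁻¹.1 * (expDiag x).1) * ((expDiag x).1 * (expDiag x)⁻¹.1) := by
          rw [hV, one_mul, mul_one]; simp only [mul_assoc]
        _ = 1 := by rw [hE, hE', one_mul]⟩
    refine ⟨U, V, Units.ext ?_⟩
    change A.1 = A.1 * V.1 * (expDiag x)⁻¹.1 * (expDiag x).1 * star V.1
    rw [mul_assoc (A.1 * V.1), hE', mul_one, mul_assoc, hV', mul_one]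
  · rintro ⟨U, V, rfl⟩
    have : (Unitary.toUnits U * expDiag x * Unitary.toUnits (star V) : GL (Fin n) ℂ).1.conjTranspose
        * (Unitary.toUnits U * expDiag x * Unitary.toUnits (star V) : GL (Fin n) ℂ).1
        = V.1 * (Matrix.diagonal fun i => ((Real.exp (x i) ^ 2 : ℝ) : ℂ)) * star V.1 := by
      have hU : star U.1 * U.1 = 1 := Unitary.coe_star_mul_self _
      rw [← hD2]
      simp only [Units.val_mul, Unitary.val_toUnits_apply, Matrix.conjTranspose_mul, hD,
        Unitary.coe_star]
      rw [← Matrix.star_eq_conjTranspose, ← Matrix.star_eq_conjTranspose, star_star]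
      calc _ = V.1 * ((expDiag x).1 * (star U.1 * U.1) * (expDiag x).1) * star V.1 := by
            simp only [mul_assoc]
        _ = _ := by rw [hU, mul_one]
    rw [this, Matrix.charpoly_mul_comm, ← mul_assoc, Unitary.coe_star_mul_self, one_mul,
      Matrix.charpoly_diagonal, Polynomial.roots_prod]
    · simp only [Polynomial.roots_X_sub_C, Multiset.bind_singleton]
    · simp only [Finset.prod_ne_zero_iff, ne_eq, Polynomial.X_sub_C_ne_zero, not_false_eq_true,
        implies_true]

/-! ### The amoeba in terms of unitary factors -/

theorem mem_matrixAmoeba_iff {n : ℕ} (f : GL (Fin n) ℂ → ℂ) (x : EuclideanSpace ℝ (Fin n)) :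
    x ∈ matrixAmoeba f ↔ ∃ U V : Matrix.unitaryGroup (Fin n) ℂ,
      f (Unitary.toUnits U * expDiag x * Unitary.toUnits (star V)) = 0 := by
  constructor
  · rintro ⟨A, hA, h⟩
    obtain ⟨U, V, rfl⟩ := (sLog_eq_mk_iff A x).1 h
    exact ⟨U, V, hA⟩
  · rintro ⟨U, V, h⟩
    exact ⟨_, h, (sLog_eq_mk_iff _ x).2 ⟨U, V, rfl⟩⟩

theorem IsRegular.continuous_comp {n : ℕ} {f : GL (Fin n) ℂ → ℂ} (hf : IsRegular f)
    {X : Type*} [TopologicalSpace X] {A : X → GL (Fin n) ℂ}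
    (hA : Continuous fun x => (A x : Matrix (Fin n) (Fin n) ℂ)) : Continuous fun x => f (A x) := by
  obtain ⟨N, p, h⟩ := hf
  simp_rw [h]
  refine Continuous.mul (Continuous.zpow₀ hA.matrix_det N fun x => Or.inl ?_) ?_
  · exact ((Matrix.isUnit_iff_isUnit_det _).1 (A x).isUnit).ne_zero
  · refine p.continuous_eval.comp (continuous_pi fun ij => ?_)
    exact hA.matrix_elem ij.1 ij.2

/-! ### Unitary orbits and the diagonal torus -/

/-- Pairs `(U, V)` of unitary matrices. -/
abbrev UnitaryPair (n : ℕ) : Type :=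
  Matrix.unitaryGroup (Fin n) ℂ × Matrix.unitaryGroup (Fin n) ℂ

/-- The matrix `U * (exp(diag x) * D) * V*` for `W = (U, V)`. With `D = 1` these are the matrices
whose singular values are `exp x`; with `D` in the complex torus they form a complex orbit. -/
def svdPoint {n : ℕ} (x : EuclideanSpace ℝ (Fin n))
    (W : UnitaryPair n) (D : GL (Fin n) ℂ) : GL (Fin n) ℂ :=
  Unitary.toUnits W.1 * (expDiag x * D) * Unitary.toUnits (star W.2)

/-- The cocharacter `t ↦ diag(t^k₁, …, t^kₙ)` of the diagonal torus. -/
def cochar {n : ℕ} (k : Fin n → ℤ) : ℂˣ →* GL (Fin n) ℂ where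
  toFun t :=
    { val := Matrix.diagonal fun i => ((t ^ k i : ℂˣ) : ℂ)
      inv := Matrix.diagonal fun i => ((t ^ (-k i) : ℂˣ) : ℂ)
      val_inv := by
        simp only [Matrix.diagonal_mul_diagonal, ← Units.val_mul, ← zpow_add, add_neg_cancel,
          zpow_zero, Units.val_one, Matrix.diagonal_one]
      inv_val := by
        simp only [Matrix.diagonal_mul_diagonal, ← Units.val_mul, ← zpow_add, neg_add_cancel,
          zpow_zero, Units.val_one, Matrix.diagonal_one] }
  map_one' := by ext; simp
  map_mul' s t := Units.ext <| by
    simp only [Units.val_mul, Matrix.diagonal_mul_diagonal, mul_zpow]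

/-- The invertible complex number `exp z`. -/
def expUnit (z : ℂ) : ℂˣ := Units.mk0 (Complex.exp z) (Complex.exp_ne_zero z)

theorem expUnit_add (z w : ℂ) : expUnit (z + w) = expUnit z * expUnit w :=
  Units.ext (Complex.exp_add z w)

/-- An integer vector as a point of Euclidean space. -/
def intVec {n : ℕ} (k : Fin n → ℤ) : EuclideanSpace ℝ (Fin n) := WithLp.toLp 2 fun i => (k i : ℝ)

theorem expDiag_add_smul {n : ℕ} (x : EuclideanSpace ℝ (Fin n)) (k : Fin n → ℤ) (s : ℝ) :
    expDiag (x + s • intVec k) = expDiag x * cochar k (expUnit s) := by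
  ext i j
  simp only [expDiag, cochar, intVec, expUnit, Units.val_mul, MonoidHom.coe_mk, OneHom.coe_mk,
    Matrix.diagonal_mul_diagonal]
  congr 2
  ext i
  rw [Units.val_zpow_eq_zpow_val, Units.val_mk0, ← Complex.exp_int_mul]
  push_cast
  rw [← Complex.exp_add]
  simp [mul_comm]

/-- `diag(e^{iθk₁}, …, e^{iθkₙ})` as a unitary matrix. -/
def rotation {n : ℕ} (k : Fin n → ℤ) (θ : ℝ) : Matrix.unitaryGroup (Fin n) ℂ :=
  ⟨(cochar k (expUnit (θ * Complex.I))).1, by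
    rw [Matrix.mem_unitaryGroup_iff', Matrix.star_eq_conjTranspose]
    simp only [cochar, MonoidHom.coe_mk, OneHom.coe_mk, Matrix.diagonal_conjTranspose,
      Matrix.diagonal_mul_diagonal, Pi.star_apply]
    rw [← Matrix.diagonal_one]
    congr 1
    ext i
    rw [Units.val_zpow_eq_zpow_val, expUnit, Units.val_mk0, ← Complex.exp_int_mul,
      Complex.star_def, ← Complex.exp_conj, ← Complex.exp_add]
    simp⟩

theorem toUnits_rotation {n : ℕ} (k : Fin n → ℤ) (θ : ℝ) :
    Unitary.toUnits (rotation k θ) = cochar k (expUnit (θ * Complex.I)) := Units.ext rfl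

theorem expDiag_mul_cochar_comm {n : ℕ} (x : EuclideanSpace ℝ (Fin n)) (k : Fin n → ℤ) (t : ℂˣ) :
    expDiag x * cochar k t = cochar k t * expDiag x := by
  ext i j
  simp only [expDiag, cochar, Units.val_mul, MonoidHom.coe_mk, OneHom.coe_mk,
    Matrix.diagonal_mul_diagonal]
  simp only [mul_comm]

/-- The argument of the torus variable is absorbed into the left unitary factor, and its modulus
into the point `x`. -/
theorem svdPoint_rotation {n : ℕ} (x : EuclideanSpace ℝ (Fin n)) (k : Fin n → ℤ) (s θ : ℝ)
    (W : UnitaryPair n) :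
    svdPoint x W (cochar k (expUnit (s + θ * Complex.I))) =
      svdPoint (x + s • intVec k) (W.1 * rotation k θ, W.2) 1 := by
  simp only [svdPoint, map_mul, toUnits_rotation, mul_one, expUnit_add]
  rw [mul_assoc (Unitary.toUnits W.1) (cochar k _), ← expDiag_mul_cochar_comm, expDiag_add_smul,
    mul_assoc (expDiag x)]

theorem notMem_matrixAmoeba_iff {n : ℕ} (f : GL (Fin n) ℂ → ℂ) (x : EuclideanSpace ℝ (Fin n)) :
    x ∈ (matrixAmoeba f)ᶜ ↔ ∀ W, f (svdPoint x W 1) ≠ 0 := by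
  rw [Set.mem_compl_iff, mem_matrixAmoeba_iff]
  simp [svdPoint]

theorem continuous_expDiag {n : ℕ} {X : Type*} [TopologicalSpace X]
    {x : X → EuclideanSpace ℝ (Fin n)} (hx : Continuous x) :
    Continuous fun a => (expDiag (x a) : Matrix (Fin n) (Fin n) ℂ) := by
  refine Continuous.matrix_diagonal (continuous_pi fun i => ?_)
  fun_prop

theorem continuous_cochar {n : ℕ} (k : Fin n → ℤ) {X : Type*} [TopologicalSpace X]
    {z : X → ℂ} (hz : Continuous z) :
    Continuous fun a => (cochar k (expUnit (z a)) : Matrix (Fin n) (Fin n) ℂ) := by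
  refine Continuous.matrix_diagonal (continuous_pi fun i => ?_)
  simp only [Units.val_zpow_eq_zpow_val, expUnit, Units.val_mk0, ← Complex.exp_int_mul]
  fun_prop

theorem continuous_svdPoint {n : ℕ} {X : Type*} [TopologicalSpace X]
    {x : X → EuclideanSpace ℝ (Fin n)} (hx : Continuous x)
    {W : X → UnitaryPair n} (hW : Continuous W)
    {D : X → GL (Fin n) ℂ} (hD : Continuous fun a => (D a : Matrix (Fin n) (Fin n) ℂ)) :
    Continuous fun a => (svdPoint (x a) (W a) (D a) : Matrix (Fin n) (Fin n) ℂ) := by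
  have h1 := continuous_expDiag hx
  simp only [svdPoint, Units.val_mul, Unitary.val_toUnits_apply, Unitary.coe_star]
  have h2 : Continuous fun a => (W a).1.1 := continuous_subtype_val.comp hW.fst
  have h3 : Continuous fun a => (W a).2.1 := continuous_subtype_val.comp hW.snd
  exact (h2.matrix_mul (h1.matrix_mul hD)).matrix_mul h3.star

theorem isOpen_compl_matrixAmoeba {n : ℕ} {f : GL (Fin n) ℂ → ℂ} (hf : IsRegular f) :
    IsOpen (matrixAmoeba f)ᶜ := by
  rw [isOpen_compl_iff]
  have h : matrixAmoeba f = Prod.fst '' {q : EuclideanSpace ℝ (Fin n) × UnitaryPair n |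
        f (svdPoint q.1 q.2 1) = 0} := by
    ext x
    rw [← not_iff_not, ← Set.mem_compl_iff, notMem_matrixAmoeba_iff]
    simp
  rw [h]
  refine isClosedMap_fst_of_compactSpace _ (isClosed_eq ?_ continuous_const)
  exact hf.continuous_comp (continuous_svdPoint continuous_fst continuous_snd continuous_const)

/-! ### Haar measure on the unitary group -/

instance instIsHaarMeasureUnitaryHaar (n : ℕ) : (unitaryHaar n).IsHaarMeasure := by
  unfold unitaryHaar; infer_instance

instance instIsProbabilityMeasureUnitaryHaar (n : ℕ) : IsProbabilityMeasure (unitaryHaar n) :=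
  ⟨by unfold unitaryHaar; exact Measure.haarMeasure_self⟩

/-- Compact groups are unimodular: a right translate of Haar measure is a left-invariant measure of
the same mass. -/
instance instIsMulRightInvariantUnitaryHaar (n : ℕ) : (unitaryHaar n).IsMulRightInvariant where
  map_mul_right_eq_self g := by
    have : IsProbabilityMeasure (Measure.map (· * g) (unitaryHaar n)) :=
      Measure.isProbabilityMeasure_map (measurable_mul_const g).aemeasurable
    have := Measure.isMulInvariant_eq_smul_of_compactSpace (Measure.map (· * g) (unitaryHaar n))
      (unitaryHaar n)
    have h := congrArg (fun μ => μ Set.univ) this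
    simp only [measure_univ, Measure.smul_apply, ENNReal.smul_def, smul_eq_mul, mul_one] at h
    rw [this, ENNReal.smul_def, ← h, one_smul]

/-! ### Connectedness of the unitary group -/

section Connected
open scoped Matrix.Norms.L2Operator

/-- A unitary matrix can be rotated by a scalar so that `-1` is not an eigenvalue, and then lies in
the ball of radius two around the identity, which is path connected. -/
theorem preconnectedSpace_unitary_matrix (n : ℕ) :
    PreconnectedSpace (unitary (Matrix (Fin n) (Fin n) ℂ)) := by
  suffices ∀ u : unitary (Matrix (Fin n) (Fin n) ℂ), Joined u 1 by
    have : PathConnectedSpace (unitary (Matrix (Fin n) (Fin n) ℂ)) :=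
      ⟨⟨1⟩, fun u v => (this u).trans (this v).symm⟩
    infer_instance
  intro u
  let c : ℝ → unitary (Matrix (Fin n) (Fin n) ℂ) := fun θ =>
    ⟨Complex.exp (θ * Complex.I) • 1, by
      rw [Unitary.mem_iff]
      simp [smul_smul, ← Complex.exp_conj, ← Complex.exp_add]⟩
  have hc : Continuous c := by
    refine Continuous.subtype_mk ?_ _
    fun_prop
  -- the spectrum is finite, so some point of the circle is not in it
  obtain ⟨θ, hθ⟩ : ∃ θ : ℝ, -Complex.exp (θ * Complex.I) ∉ spectrum ℂ u.1 := by
    by_contra! h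
    have hfin : (spectrum ℂ u.1).Finite := Matrix.finite_spectrum _
    have : Set.InjOn (fun θ : ℝ => -Complex.exp (θ * Complex.I)) (Set.Ico 0 1) := by
      intro a ha b hb hab
      simp only [neg_inj] at hab
      have hπ := Real.pi_gt_three
      have := Complex.exp_inj_of_neg_pi_lt_of_le_pi (by simp; linarith [ha.1])
        (by simp; linarith [ha.2]) (by simp; linarith [hb.1]) (by simp; linarith [hb.2]) hab
      simpa using this
    exact (Set.Ico_infinite (zero_lt_one' ℝ)) (Set.Finite.of_injOn (fun a _ => h a) this hfin)
  have h1 : Joined u (c θ) := by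
    refine Joined.symm (Unitary.joined _ _ ?_)
    rw [Unitary.norm_sub_eq, Unitary.norm_sub_one_lt_two_iff (SetLike.coe_mem _)]
    intro h
    let r : ℂˣ := Units.mk0 (Complex.exp (θ * Complex.I)) (Complex.exp_ne_zero _)
    refine hθ ?_
    have h3 := (spectrum.smul_mem_smul_iff (r := r)).2 h
    have h4 : r • (u * star (c θ)).1 = u.1 := by
      simp [c, r, Units.smul_def, smul_smul, ← Complex.exp_conj, ← Complex.exp_add]
    rw [h4] at h3
    simpa [r, Units.smul_def] using h3
  refine h1.trans ?_
  have h2 : c 0 = 1 := by ext1; simp [c]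
  rw [← h2]
  exact (PathConnectedSpace.joined θ 0).map hc
end Connected

instance instPreconnectedSpaceUnitaryGroup (n : ℕ) :
    PreconnectedSpace (Matrix.unitaryGroup (Fin n) ℂ) :=
  preconnectedSpace_unitary_matrix n

/-! ### Laurent polynomials -/

/-- A function on `ℂˣ` is a Laurent polynomial if it becomes a polynomial after multiplication by
some power of the variable. -/
def IsLaurent (g : ℂˣ → ℂ) : Prop :=
  ∃ (M : ℕ) (P : Polynomial ℂ), ∀ t : ℂˣ, (t : ℂ) ^ M * g t = P.eval (t : ℂ)

namespace IsLaurent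

theorem const (c : ℂ) : IsLaurent fun _ => c := ⟨0, Polynomial.C c, by simp⟩

theorem add {g h : ℂˣ → ℂ} (hg : IsLaurent g) (hh : IsLaurent h) :
    IsLaurent fun t => g t + h t := by
  obtain ⟨M, P, hP⟩ := hg
  obtain ⟨N, Q, hQ⟩ := hh
  refine ⟨M + N, Polynomial.X ^ N * P + Polynomial.X ^ M * Q, fun t => ?_⟩
  simp only [Polynomial.eval_add, Polynomial.eval_mul, Polynomial.eval_pow, Polynomial.eval_X,
    ← hP, ← hQ]
  ring

theorem mul {g h : ℂˣ → ℂ} (hg : IsLaurent g) (hh : IsLaurent h) :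
    IsLaurent fun t => g t * h t := by
  obtain ⟨M, P, hP⟩ := hg
  obtain ⟨N, Q, hQ⟩ := hh
  refine ⟨M + N, P * Q, fun t => ?_⟩
  simp only [Polynomial.eval_mul, ← hP, ← hQ]
  ring

theorem zpow (m : ℤ) : IsLaurent fun t => ((t ^ m : ℂˣ) : ℂ) := by
  obtain ⟨k, rfl | rfl⟩ := m.eq_nat_or_neg
  · exact ⟨0, Polynomial.X ^ k, by simp⟩
  · exact ⟨k, 1, fun t => by simp⟩

theorem sum {ι : Type*} (s : Finset ι) {g : ι → ℂˣ → ℂ} (hg : ∀ i, IsLaurent (g i)) :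
    IsLaurent fun t => ∑ i ∈ s, g i t := by
  classical
  induction s using Finset.induction_on with
  | empty => simpa using const 0
  | insert i s hi ih =>
    simp_rw [Finset.sum_insert hi]
    exact (hg i).add ih

theorem mvPolynomial_eval {σ : Type*} (p : MvPolynomial σ ℂ) {g : ℂˣ → σ → ℂ}
    (hg : ∀ i, IsLaurent fun t => g t i) : IsLaurent fun t => MvPolynomial.eval (g t) p := by
  induction p using MvPolynomial.induction_on with
  | C a => simpa using const a
  | add p q hp hq => simpa using hp.add hq
  | mul_X p i hp => simpa using hp.mul (hg i)

end IsLaurent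

theorem det_cochar {n : ℕ} (k : Fin n → ℤ) (t : ℂˣ) :
    (cochar k t).1.det = ((t ^ ∑ i, k i : ℂˣ) : ℂ) := by
  simp only [cochar, MonoidHom.coe_mk, OneHom.coe_mk, Matrix.det_diagonal,
    Units.val_zpow_eq_zpow_val]
  classical
  induction (Finset.univ : Finset (Fin n)) using Finset.induction_on with
  | empty => simp
  | insert i s hi ih =>
    rw [Finset.prod_insert hi, Finset.sum_insert hi, zpow_add₀ t.ne_zero, ih]

/-- The restriction of `f` to the one-parameter family `U * exp(diag x) * diag(t^k) * V*`. -/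
def cocharRestrict {n : ℕ} (f : GL (Fin n) ℂ → ℂ) (k : Fin n → ℤ) (x : EuclideanSpace ℝ (Fin n))
    (W : UnitaryPair n) : ℂˣ → ℂ :=
  fun t => f (svdPoint x W (cochar k t))

theorem IsRegular.isLaurent {n : ℕ} {f : GL (Fin n) ℂ → ℂ} (hf : IsRegular f)
    (x : EuclideanSpace ℝ (Fin n))
    (W : UnitaryPair n) (k : Fin n → ℤ) :
    IsLaurent (cocharRestrict f k x W) := by
  obtain ⟨N, p, h⟩ := hf
  unfold cocharRestrict
  simp_rw [h]
  refine IsLaurent.mul ?_ (IsLaurent.mvPolynomial_eval p fun ij => ?_)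
  · simp only [svdPoint, Units.val_mul, Matrix.det_mul, det_cochar, mul_zpow]
    simp only [← Units.val_zpow_eq_zpow_val, ← zpow_mul]
    exact (((IsLaurent.const _).mul ((IsLaurent.const _).mul (IsLaurent.zpow _))).mul
      (IsLaurent.const _))
  · simp only [svdPoint, Units.val_mul, Matrix.mul_apply]
    refine IsLaurent.sum _ fun a => IsLaurent.mul (IsLaurent.sum _ fun b => ?_) (.const _)
    refine (IsLaurent.const _).mul (IsLaurent.sum _ fun c => (IsLaurent.const _).mul ?_)
    simp only [cochar, MonoidHom.coe_mk, OneHom.coe_mk, Matrix.diagonal_apply]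
    split_ifs
    · exact IsLaurent.zpow _
    · exact IsLaurent.const 0

/-! ### Circle means of Laurent polynomials -/

/-- The mean of `log ‖g‖` over the circle of radius `exp s`. -/
def circleMean (g : ℂˣ → ℂ) (s : ℝ) : ℝ :=
  (2 * Real.pi)⁻¹ * ∫ θ in (0 : ℝ)..2 * Real.pi, Real.log ‖g (expUnit (s + θ * Complex.I))‖

/-- `g` has no zero on the circle of radius `exp s`. -/
def ZeroFreeAt (g : ℂˣ → ℂ) (s : ℝ) : Prop := ∀ θ : ℝ, g (expUnit (s + θ * Complex.I)) ≠ 0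

theorem circleAverage_sum_log_norm_sub (Z : Multiset ℂ) {r : ℝ} (hr : r ≠ 0) :
    CircleIntegrable (fun z => (Z.map fun a => Real.log ‖z - a‖).sum) 0 r ∧
    Real.circleAverage (fun z => (Z.map fun a => Real.log ‖z - a‖).sum) 0 r =
      (Z.map fun a => Real.log r + Real.posLog (r⁻¹ * ‖a‖)).sum := by
  induction Z using Multiset.induction_on with
  | empty => simp [Real.circleAverage_const, CircleIntegrable]
  | cons a Z ih =>
    simp only [Multiset.map_cons, Multiset.sum_cons]
    have h := circleIntegrable_log_norm_sub_const (a := a) (c := 0) r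
    refine ⟨h.add ih.1, ?_⟩
    rw [Real.circleAverage_fun_add h ih.1, ih.2,
      circleAverage_log_norm_sub_const_eq_log_radius_add_posLog hr]
    simp

theorem log_norm_prod_sub {Z : Multiset ℂ} {z : ℂ} (h : (Z.map fun a => z - a).prod ≠ 0) :
    Real.log ‖(Z.map fun a => z - a).prod‖ = (Z.map fun a => Real.log ‖z - a‖).sum := by
  induction Z using Multiset.induction_on with
  | empty => simp
  | cons a Z ih =>
    simp only [Multiset.map_cons, Multiset.prod_cons, Multiset.sum_cons] at h ⊢
    rw [norm_mul, Real.log_mul (norm_ne_zero_iff.2 (left_ne_zero_of_mul h))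
      (norm_ne_zero_iff.2 (right_ne_zero_of_mul h)), ih (right_ne_zero_of_mul h)]

theorem expUnit_add_mul_I (s θ : ℝ) :
    (expUnit (s + θ * Complex.I) : ℂ) = circleMap 0 (Real.exp s) θ := by
  simp [expUnit, circleMap, Complex.exp_add]

/-- Jensen's formula for a Laurent polynomial, in terms of the roots of its numerator. -/
theorem circleMean_eq {g : ℂˣ → ℂ} {M : ℕ} {P : Polynomial ℂ}
    (h : ∀ t : ℂˣ, (t : ℂ) ^ M * g t = P.eval (t : ℂ)) {s : ℝ} (hs : ZeroFreeAt g s) :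
    circleMean g s = Real.log ‖P.leadingCoeff‖ +
      (P.roots.map fun a => s + Real.posLog (Real.exp (-s) * ‖a‖)).sum - M * s := by
  have hr : Real.exp s ≠ 0 := (Real.exp_pos s).ne'
  have h1 : circleMean g s = Real.circleAverage (fun z => (Real.log ‖P.leadingCoeff‖ - M * s) +
      (P.roots.map fun a => Real.log ‖z - a‖).sum) 0 (Real.exp s) := by
    rw [circleMean, Real.circleAverage_def, smul_eq_mul]
    congr 1
    refine intervalIntegral.integral_congr fun θ _ => ?_
    set t := expUnit (s + θ * Complex.I) with ht
    have htz : (t : ℂ) = circleMap 0 (Real.exp s) θ := expUnit_add_mul_I s θ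
    have htn : ‖(t : ℂ)‖ = Real.exp s := by rw [htz]; simp
    have hP : P.eval (t : ℂ) ≠ 0 := by
      rw [← h]
      exact mul_ne_zero (pow_ne_zero _ t.ne_zero) (hs θ)
    have e1 : Real.log ‖P.eval (t : ℂ)‖ = M * s + Real.log ‖g t‖ := by
      rw [← h, norm_mul, norm_pow, htn, Real.log_mul (by positivity) (norm_ne_zero_iff.2 (hs θ)),
        Real.log_pow, Real.log_exp]
    have e2 : Real.log ‖P.eval (t : ℂ)‖ =
        Real.log ‖P.leadingCoeff‖ + (P.roots.map fun a => Real.log ‖(t : ℂ) - a‖).sum := by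
      have hsp := IsAlgClosed.splits P
      have hprod := hsp.eval_eq_prod_roots (t : ℂ)
      rw [hprod] at hP ⊢
      rw [norm_mul, Real.log_mul (norm_ne_zero_iff.2 (left_ne_zero_of_mul hP))
        (norm_ne_zero_iff.2 (right_ne_zero_of_mul hP)),
        log_norm_prod_sub (right_ne_zero_of_mul hP)]
    simp only [← htz]
    linarith
  rw [h1, Real.circleAverage_fun_add (by simp [CircleIntegrable])
    (circleAverage_sum_log_norm_sub _ hr).1, Real.circleAverage_const,
    (circleAverage_sum_log_norm_sub _ hr).2, Real.log_exp, ← Real.exp_neg]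
  ring

open Classical in
/-- Counting zeros inside the disc of radius `exp s` (and subtracting the order of the pole at the
origin) gives the slope of the circle mean of a Laurent polynomial. Equal counts at the two
boundary circles of an annulus exclude zeros in between. -/
theorem IsLaurent.exists_slope {g : ℂˣ → ℂ} (hg : IsLaurent g) : ∃ ν : ℝ → ℤ,
    (∀ s₀ s₁, s₀ ≤ s₁ → (∀ s ∈ Set.Icc s₀ s₁, ZeroFreeAt g s) →
      circleMean g s₁ - circleMean g s₀ = (s₁ - s₀) * ν s₀) ∧
    (∀ s₀ s₁, s₀ ≤ s₁ → ZeroFreeAt g s₀ → ZeroFreeAt g s₁ → ν s₀ = ν s₁ →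
      ∀ s ∈ Set.Icc s₀ s₁, ZeroFreeAt g s) := by
  obtain ⟨M, P, h⟩ := hg
  have hne : ∀ {s}, ZeroFreeAt g s → P ≠ 0 := by
    rintro s hs rfl
    have := h (expUnit (s + (0 : ℝ) * Complex.I))
    simp only [Polynomial.eval_zero, mul_eq_zero, pow_eq_zero_iff', Units.ne_zero, false_and,
      false_or] at this
    exact hs 0 this
  have hroot : ∀ {s}, ZeroFreeAt g s → ∀ a ∈ P.roots, ‖a‖ ≠ Real.exp s := by
    intro s hs a ha hn
    have ha0 : a ≠ 0 := by rintro rfl; simp at hn; exact (Real.exp_pos s).ne hn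
    have : a = expUnit (s + a.arg * Complex.I) := by
      rw [expUnit_add_mul_I, circleMap, ← hn]
      simp
    apply hs a.arg
    have h2 := h (expUnit (s + a.arg * Complex.I))
    rw [← this, (Polynomial.mem_roots'.1 ha).2] at h2
    exact (mul_eq_zero.1 h2).resolve_left (pow_ne_zero _ ha0)
  -- a root contributes `s` to the circle mean if it is inside the disc, and a constant otherwise
  refine ⟨fun s => (P.roots.filter fun a => ‖a‖ < Real.exp s).card - M, ?_, ?_⟩
  · intro s₀ s₁ hs hz
    have hz0 := hz s₀ ⟨le_rfl, hs⟩
    rw [circleMean_eq h (hz s₁ ⟨hs, le_rfl⟩), circleMean_eq h hz0]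
    have key : ∀ Z : Multiset ℂ, (∀ a ∈ Z, ∀ s ∈ Set.Icc s₀ s₁, ‖a‖ ≠ Real.exp s) →
        (Z.map fun a => s₁ + Real.posLog (Real.exp (-s₁) * ‖a‖)).sum =
        (Z.map fun a => s₀ + Real.posLog (Real.exp (-s₀) * ‖a‖)).sum +
          (s₁ - s₀) * (Z.filter fun a => ‖a‖ < Real.exp s₀).card := by
      intro Z
      induction Z using Multiset.induction_on with
      | empty => simp
      | cons a Z ih =>
        intro hZ
        simp only [Multiset.map_cons, Multiset.sum_cons,
          ih fun b hb => hZ b (Multiset.mem_cons_of_mem hb)]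
        have ha := hZ a (Multiset.mem_cons_self a Z)
        by_cases hlt : ‖a‖ < Real.exp s₀
        · rw [Multiset.filter_cons_of_pos (p := fun a : ℂ => ‖a‖ < Real.exp s₀) _ hlt,
            Multiset.card_cons]
          have hlt1 : ‖a‖ < Real.exp s₁ := hlt.trans_le (Real.exp_le_exp.2 hs)
          have e : ∀ s, ‖a‖ < Real.exp s → Real.posLog (Real.exp (-s) * ‖a‖) = 0 := by
            intro s hs
            rw [Real.posLog_eq_zero_iff, abs_of_nonneg (by positivity), Real.exp_neg,
              inv_mul_le_one₀ (Real.exp_pos s)]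
            exact hs.le
          rw [e _ hlt, e _ hlt1]
          push_cast
          ring
        · rw [Multiset.filter_cons_of_neg (p := fun a : ℂ => ‖a‖ < Real.exp s₀) _ hlt]
          have hgt1 : Real.exp s₁ < ‖a‖ := by
            by_contra! hle
            have hp : 0 < ‖a‖ := (Real.exp_pos s₀).trans_le (not_lt.1 hlt)
            refine ha (Real.log ‖a‖) ⟨?_, ?_⟩ (Real.exp_log hp).symm
            · exact (Real.le_log_iff_exp_le hp).2 (not_lt.1 hlt)
            · exact (Real.log_le_iff_le_exp hp).2 hle
          have hp : 0 < ‖a‖ := (Real.exp_pos s₁).trans hgt1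
          have e : ∀ s, Real.exp s ≤ ‖a‖ →
              Real.posLog (Real.exp (-s) * ‖a‖) = Real.log ‖a‖ - s := by
            intro s hs
            rw [Real.posLog_eq_log, Real.log_mul (by positivity) hp.ne', Real.log_exp]
            · ring
            · rw [abs_of_nonneg (by positivity), Real.exp_neg, one_le_inv_mul₀ (Real.exp_pos s)]
              exact hs
          rw [e _ (not_lt.1 hlt), e _ hgt1.le]
          ring
    rw [key P.roots fun a ha s hs => hroot (hz s hs) a ha]
    push_cast
    ring
  · intro s₀ s₁ hs h0 h1 heq s hsI θ hθ
    set t := expUnit (s + θ * Complex.I) with ht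
    have htn : ‖(t : ℂ)‖ = Real.exp s := by rw [ht, expUnit_add_mul_I]; simp
    have hroot_t : (t : ℂ) ∈ P.roots := by
      rw [Polynomial.mem_roots (hne h0), Polynomial.IsRoot, ← h, hθ, mul_zero]
    have hle : (P.roots.filter fun a => ‖a‖ < Real.exp s₀) ≤
        P.roots.filter fun a => ‖a‖ < Real.exp s₁ :=
      Multiset.monotone_filter_right _ fun a ha => ha.trans_le (Real.exp_le_exp.2 hs)
    have hfe := Multiset.eq_of_le_of_card_le hle (by simp only [sub_left_inj] at heq; omega)
    have hmem : (t : ℂ) ∈ P.roots.filter fun a => ‖a‖ < Real.exp s₁ := by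
      rw [Multiset.mem_filter]
      refine ⟨hroot_t, lt_of_le_of_ne ?_ (hroot h1 _ hroot_t)⟩
      rw [htn]
      exact Real.exp_le_exp.2 hsI.2
    rw [← hfe, Multiset.mem_filter, htn] at hmem
    exact absurd hmem.2 (not_lt.2 (Real.exp_le_exp.2 hsI.1))

/-! ### Circle means along torus directions -/

/-- The mean of `log ‖f‖` over the circle of matrices `U * exp(diag x) * diag(t^k) * V*` with
`|t| = 1`, for `W = (U, V)`. -/
def orbitMean {n : ℕ} (f : GL (Fin n) ℂ → ℂ) (k : Fin n → ℤ) (x : EuclideanSpace ℝ (Fin n))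
    (W : UnitaryPair n) : ℝ :=
  circleMean (cocharRestrict f k x W) 0

section

variable {n : ℕ} {f : GL (Fin n) ℂ → ℂ} {k : Fin n → ℤ}

theorem rotation_zero (k : Fin n → ℤ) : rotation k 0 = 1 := by
  apply Unitary.toUnits_injective
  rw [toUnits_rotation, map_one, ← map_one (cochar k)]
  congr 1
  ext
  simp [expUnit]

/-- A point lies outside the amoeba exactly if the restrictions for all unitary factors have no zero
on the corresponding circle. -/
theorem forall_zeroFreeAt_cocharRestrict {x : EuclideanSpace ℝ (Fin n)} {s : ℝ} :
    (∀ W, ZeroFreeAt (cocharRestrict f k x W) s) ↔ x + s • intVec k ∈ (matrixAmoeba f)ᶜ := by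
  rw [notMem_matrixAmoeba_iff]
  simp only [ZeroFreeAt, cocharRestrict, svdPoint_rotation]
  refine ⟨fun h W => ?_, fun h W θ => h _⟩
  simpa [rotation_zero] using h W 0

theorem circleMean_cocharRestrict (x : EuclideanSpace ℝ (Fin n)) (W : UnitaryPair n) (s : ℝ) :
    circleMean (cocharRestrict f k x W) s = orbitMean f k (x + s • intVec k) W := by
  simp only [orbitMean, circleMean, cocharRestrict, svdPoint_rotation, zero_smul, add_zero]

theorem orbitMean_eq (x : EuclideanSpace ℝ (Fin n)) (W : UnitaryPair n) :
    orbitMean f k x W = (2 * Real.pi)⁻¹ * ∫ θ in (0 : ℝ)..2 * Real.pi,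
      Real.log ‖f (svdPoint x (W.1 * rotation k θ, W.2) 1)‖ := by
  simp only [orbitMean, circleMean, cocharRestrict, svdPoint_rotation, zero_smul, add_zero]

theorem continuous_rotation (k : Fin n → ℤ) : Continuous (rotation k) :=
  Continuous.subtype_mk (continuous_cochar k (by fun_prop)) _

theorem continuousOn_orbitMean (hf : IsRegular f) :
    ContinuousOn (fun q : EuclideanSpace ℝ (Fin n) × UnitaryPair n =>
      orbitMean f k q.1 q.2)
      ((matrixAmoeba f)ᶜ ×ˢ Set.univ) := by
  rw [continuousOn_iff_continuous_domRestrict]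
  simp only [Set.domRestrict_def, orbitMean_eq]
  refine continuous_const.mul
    (intervalIntegral.continuous_parametric_intervalIntegral_of_continuous' ?_ _ _)
  refine Continuous.log (Continuous.norm (hf.continuous_comp (continuous_svdPoint ?_ ?_
    continuous_const))) fun q => norm_ne_zero_iff.2 ((notMem_matrixAmoeba_iff _ _).1 q.1.2.1 _)
  · fun_prop
  · have := continuous_rotation k
    fun_prop

theorem continuous_log_norm_svdPoint (hf : IsRegular f) {x : EuclideanSpace ℝ (Fin n)}
    (hx : x ∈ (matrixAmoeba f)ᶜ) : Continuous fun W => Real.log ‖f (svdPoint x W 1)‖ :=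
  Continuous.log (Continuous.norm (hf.continuous_comp (continuous_svdPoint continuous_const
    continuous_id continuous_const))) fun W =>
      norm_ne_zero_iff.2 ((notMem_matrixAmoeba_iff _ _).1 hx W)

theorem continuous_orbitMean (hf : IsRegular f) {x : EuclideanSpace ℝ (Fin n)}
    (hx : x ∈ (matrixAmoeba f)ᶜ) : Continuous (orbitMean f k x) := by
  have h : ContinuousOn (orbitMean f k x) Set.univ :=
    (continuousOn_orbitMean (k := k) hf).comp (f := fun W => (x, W)) (by fun_prop)
      fun W _ => ⟨hx, trivial⟩
  exact continuousOn_univ.1 h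

instance instSecondCountableTopologyUnitaryGroup (n : ℕ) :
    SecondCountableTopology (Matrix.unitaryGroup (Fin n) ℂ) := by
  have : SecondCountableTopology (Matrix (Fin n) (Fin n) ℂ) :=
    inferInstanceAs (SecondCountableTopology (Fin n → Fin n → ℂ))
  exact TopologicalSpace.Subtype.secondCountableTopology _

theorem integrable_of_continuous {φ : UnitaryPair n → ℝ} (hφ : Continuous φ) :
    Integrable φ ((unitaryHaar n).prod (unitaryHaar n)) :=
  hφ.integrable_of_hasCompactSupport (HasCompactSupport.of_compactSpace φ)

/-! ### The Ronkin function as a mean of circle means -/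

theorem extIntegral_coe {α : Type*} [MeasurableSpace α] {μ : Measure α} {φ : α → ℝ}
    (hφ : Integrable φ μ) :
    extIntegral μ (fun a => (φ a : EReal)) = ((∫ a, φ a ∂μ : ℝ) : EReal) := by
  have h1 : ∫⁻ a, ENNReal.ofReal (φ a) ∂μ ≠ ⊤ := hφ.lintegral_lt_top.ne
  have h2 : ∫⁻ a, ENNReal.ofReal (-φ a) ∂μ ≠ ⊤ := hφ.neg.lintegral_lt_top.ne
  rw [integral_eq_lintegral_pos_part_sub_lintegral_neg_part hφ, EReal.coe_sub,
    EReal.coe_ennreal_toReal h1, EReal.coe_ennreal_toReal h2, extIntegral]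
  simp [← EReal.coe_neg, EReal.toENNReal_of_ne_top]

theorem ronkin_eq_integral_log (hf : IsRegular f) {x : EuclideanSpace ℝ (Fin n)}
    (hx : x ∈ (matrixAmoeba f)ᶜ) :
    ronkin f x = ((∫ W, Real.log ‖f (svdPoint x W 1)‖
      ∂((unitaryHaar n).prod (unitaryHaar n)) : ℝ) : EReal) := by
  rw [← extIntegral_coe (integrable_of_continuous (continuous_log_norm_svdPoint hf hx)), ronkin]
  congr 1
  ext W
  have h := norm_pos_iff.2 ((notMem_matrixAmoeba_iff _ _).1 hx W)
  rw [← ENNReal.log_ofReal_of_pos h, ofReal_norm, svdPoint, mul_one]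

/-- Right invariance of Haar measure allows the Ronkin integrand to be averaged over circles. -/
theorem ronkin_eq_integral_orbitMean (hf : IsRegular f) (k : Fin n → ℤ)
    {x : EuclideanSpace ℝ (Fin n)} (hx : x ∈ (matrixAmoeba f)ᶜ) :
    ronkin f x =
      ((∫ W, orbitMean f k x W ∂((unitaryHaar n).prod (unitaryHaar n)) : ℝ) : EReal) := by
  rw [ronkin_eq_integral_log hf hx]
  congr 1
  simp only [orbitMean_eq]
  rw [integral_const_mul]
  have hc : Continuous (Function.uncurry fun (θ : ℝ) (W : UnitaryPair n) =>
      Real.log ‖f (svdPoint x (W.1 * rotation k θ, W.2) 1)‖) := by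
    have h := continuous_rotation k
    exact (continuous_log_norm_svdPoint hf hx).comp (g := fun W => Real.log ‖f (svdPoint x W 1)‖)
      (f := fun q : ℝ × UnitaryPair n => (q.2.1 * rotation k q.1, q.2.2)) (by fun_prop)
  rw [← intervalIntegral_integral_swap]
  · have h : ∀ θ : ℝ, ∫ W, Real.log ‖f (svdPoint x (W.1 * rotation k θ, W.2) 1)‖
        ∂((unitaryHaar n).prod (unitaryHaar n)) = ∫ W, Real.log ‖f (svdPoint x W 1)‖
        ∂((unitaryHaar n).prod (unitaryHaar n)) := fun θ => by
      have := integral_mul_right_eq_self (μ := (unitaryHaar n).prod (unitaryHaar n))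
        (fun W => Real.log ‖f (svdPoint x W 1)‖) (rotation k θ, 1)
      simpa [Prod.mul_def] using this
    simp only [h, intervalIntegral.integral_const, smul_eq_mul, sub_zero]
    rw [← mul_assoc, inv_mul_cancel₀ (by positivity), one_mul]
  · obtain ⟨B, hB⟩ := isCompact_univ.exists_bound_of_continuousOn
      (continuous_log_norm_svdPoint hf hx).continuousOn
    have : Fact (volume (Set.uIoc 0 (2 * Real.pi)) < ⊤) := ⟨by simp [Set.uIoc]⟩
    exact Integrable.of_bound hc.aestronglyMeasurable B
      (Filter.Eventually.of_forall fun q => hB _ trivial)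

/-! ### Slopes of the Ronkin function -/

/-- Short segments in direction `v` starting near a point of an open set stay in the set, with a
length that is uniform near that point. -/
theorem exists_pos_forall_add_smul_mem {E : Type*} [NormedAddCommGroup E] [NormedSpace ℝ E]
    {C : Set E} (hC : IsOpen C) {x : E} (hx : x ∈ C) (v : E) :
    ∃ τ > 0, ∀ᶠ y in nhds x, ∀ s ∈ Set.Icc (0 : ℝ) τ, y + s • v ∈ C := by
  have h : ∀ᶠ q : E × ℝ in nhds (x, 0), q.1 + q.2 • v ∈ C :=
    (hC.preimage (f := fun q : E × ℝ => q.1 + q.2 • v) (by fun_prop)).mem_nhds (by simpa using hx)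
  rw [nhds_prod_eq, Filter.eventually_prod_iff] at h
  obtain ⟨p, hp, q, hq, h⟩ := h
  obtain ⟨τ, hτ, hq⟩ := Metric.eventually_nhds_iff.1 hq
  refine ⟨τ / 2, by positivity, hp.mono fun y hy s hs => h hy (hq ?_)⟩
  rw [dist_zero_right, Real.norm_eq_abs, abs_of_nonneg hs.1]
  linarith [hs.2]

/-- On a connected open subset of the complement of the amoeba, all circle means in direction `k`
grow with one and the same integer slope: the slope is an integer that depends continuously on the
point and on the unitary factors. -/
theorem exists_orbitMean_slope (hf : IsRegular f) (k : Fin n → ℤ)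
    {C : Set (EuclideanSpace ℝ (Fin n))} (hC : IsOpen C) (hC' : IsPreconnected C)
    (hCS : C ⊆ (matrixAmoeba f)ᶜ) : ∃ m : ℤ, ∀ x ∈ C, ∀ W, ∀ τ ≥ (0 : ℝ),
      (∀ s ∈ Set.Icc 0 τ, x + s • intVec k ∈ (matrixAmoeba f)ᶜ) →
      orbitMean f k (x + τ • intVec k) W - orbitMean f k x W = τ * m := by
  choose ν hν using fun x W => (hf.isLaurent x W k).exists_slope
  have hslope : ∀ x W, ∀ τ ≥ (0 : ℝ),
      (∀ s ∈ Set.Icc 0 τ, x + s • intVec k ∈ (matrixAmoeba f)ᶜ) →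
      orbitMean f k (x + τ • intVec k) W - orbitMean f k x W = τ * ν x W 0 := by
    intro x W τ hτ h
    have := (hν x W).1 0 τ hτ fun s hs => forall_zeroFreeAt_cocharRestrict.2 (h s hs) W
    have e0 := circleMean_cocharRestrict (f := f) (k := k) x W 0
    have e1 := circleMean_cocharRestrict (f := f) (k := k) x W τ
    simp only [zero_smul, add_zero] at e0
    rwa [e0, e1, sub_zero] at this
  have hcont : ContinuousOn (fun q : EuclideanSpace ℝ (Fin n) × UnitaryPair n =>
      ν q.1 q.2 0)
      (C ×ˢ Set.univ) := by
    rintro ⟨x, W⟩ ⟨hx, -⟩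
    refine ContinuousAt.continuousWithinAt ?_
    rw [Int.isClosedEmbedding_coe_real.isInducing.continuousAt_iff]
    -- near `(x, W)` the slope is a difference quotient with a fixed step `τ`
    obtain ⟨τ, hτ, hev⟩ := exists_pos_forall_add_smul_mem hC hx (intVec k)
    have hcm : ∀ y ∈ C, ContinuousAt (fun q : EuclideanSpace ℝ (Fin n) × UnitaryPair n =>
        orbitMean f k q.1 q.2)
        (y, W) := fun y hy =>
      (continuousOn_orbitMean hf).continuousAt
        (((isOpen_compl_matrixAmoeba hf).prod isOpen_univ).mem_nhds ⟨hCS hy, trivial⟩)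
    have h1 : ContinuousAt (fun q : EuclideanSpace ℝ (Fin n) × UnitaryPair n =>
        (orbitMean f k (q.1 + τ • intVec k) q.2 - orbitMean f k q.1 q.2) / τ) (x, W) := by
      refine ContinuousAt.div_const (ContinuousAt.sub ?_ (hcm x hx)) τ
      refine ContinuousAt.comp (x := (x, W))
        (f := fun q : EuclideanSpace ℝ (Fin n) × UnitaryPair n =>
        (q.1 + τ • intVec k, q.2)) (hcm _ (hev.self_of_nhds τ ⟨hτ.le, le_rfl⟩)) ?_
      fun_prop
    refine h1.congr ?_
    have hev' : ∀ᶠ q : EuclideanSpace ℝ (Fin n) × UnitaryPair n in nhds (x, W),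
        ∀ s ∈ Set.Icc (0 : ℝ) τ, q.1 + s • intVec k ∈ C := continuousAt_fst.eventually hev
    filter_upwards [hev'] with q hq
    rw [hslope q.1 q.2 τ hτ.le fun s hs => hCS (hq s hs)]
    simp [hτ.ne']
  rcases C.eq_empty_or_nonempty with rfl | ⟨x₀, hx₀⟩
  · exact ⟨0, by simp⟩
  · refine ⟨ν x₀ (1, 1) 0, fun x hx W τ hτ h => ?_⟩
    rw [hslope x W τ hτ h]
    have := (hC'.prod isPreconnected_univ).constant hcont (x := (x, W)) (y := (x₀, (1, 1)))
      ⟨hx, trivial⟩ ⟨hx₀, trivial⟩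
    simp only at this
    rw [this]

theorem ronkin_toReal (hf : IsRegular f) (k : Fin n → ℤ)
    {x : EuclideanSpace ℝ (Fin n)} (hx : x ∈ (matrixAmoeba f)ᶜ) :
    (ronkin f x).toReal = ∫ W, orbitMean f k x W ∂((unitaryHaar n).prod (unitaryHaar n)) := by
  rw [ronkin_eq_integral_orbitMean hf k hx, EReal.toReal_coe]

/-- Integration over the unitary factors turns a common slope of all circle means into the slope of
the Ronkin function. -/
theorem ronkin_add_smul_of_slope (hf : IsRegular f) {C : Set (EuclideanSpace ℝ (Fin n))}
    (hCS : C ⊆ (matrixAmoeba f)ᶜ) {m : ℤ}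
    (hm : ∀ x ∈ C, ∀ W, ∀ τ ≥ (0 : ℝ),
      (∀ s ∈ Set.Icc 0 τ, x + s • intVec k ∈ (matrixAmoeba f)ᶜ) →
      orbitMean f k (x + τ • intVec k) W - orbitMean f k x W = τ * m)
    {x : EuclideanSpace ℝ (Fin n)} {τ : ℝ} (h : segment ℝ x (x + τ • intVec k) ⊆ C) :
    (ronkin f (x + τ • intVec k)).toReal = (ronkin f x).toReal + τ * m := by
  have key : ∀ (x : EuclideanSpace ℝ (Fin n)) (τ : ℝ), 0 ≤ τ →
      segment ℝ x (x + τ • intVec k) ⊆ C →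
      (ronkin f (x + τ • intVec k)).toReal = (ronkin f x).toReal + τ * m := by
    intro x τ hτ h
    have hx := h (left_mem_segment ℝ _ _)
    have hy := h (right_mem_segment ℝ _ _)
    rw [ronkin_toReal hf k (hCS hx), ronkin_toReal hf k (hCS hy)]
    have e : ∀ W, orbitMean f k (x + τ • intVec k) W = orbitMean f k x W + τ * m := fun W => by
      rw [← hm x hx W τ hτ fun s hs => hCS (h ?_)]
      · ring
      · rw [segment_eq_image']
        rcases hτ.eq_or_lt with rfl | hτ
        · exact ⟨0, by simp, by simp [le_antisymm hs.2 hs.1]⟩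
        · refine ⟨s / τ, ⟨div_nonneg hs.1 hτ.le, (div_le_one hτ).2 hs.2⟩, ?_⟩
          simp [smul_smul, hτ.ne']
    simp only [e]
    rw [integral_add (integrable_of_continuous (continuous_orbitMean hf (hCS hx)))
      (integrable_const _)]
    simp
  rcases le_total 0 τ with hτ | hτ
  · exact key x τ hτ h
  · have := key (x + τ • intVec k) (-τ) (by linarith) (by
      simpa [segment_symm ℝ (x + τ • intVec k) x] using h)
    simp only [neg_smul, add_neg_cancel_right] at this
    linarith

/-- On a component of the complement the Ronkin function is locally affine with integer slopes. -/
theorem exists_ronkin_affine (hf : IsRegular f) {C : Set (EuclideanSpace ℝ (Fin n))}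
    (hC : IsOpen C) (hC' : IsPreconnected C) (hCS : C ⊆ (matrixAmoeba f)ᶜ) :
    ∃ m : Fin n → ℤ, ∀ x ∈ C, ∃ r > 0, Metric.ball x r ⊆ C ∧ ∀ y ∈ Metric.ball x r,
      (ronkin f y).toReal = (ronkin f x).toReal + ∑ i, (m i : ℝ) * (y i - x i) := by
  choose m hm using fun j : Fin n =>
    exists_orbitMean_slope hf (Pi.single j 1) hC hC' hCS
  refine ⟨m, fun x hx => ?_⟩
  obtain ⟨r, hr, hball⟩ := Metric.isOpen_iff.1 hC x hx
  refine ⟨r, hr, hball, fun y hy => ?_⟩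
  -- move from `x` to `y` one coordinate at a time
  let z : Finset (Fin n) → EuclideanSpace ℝ (Fin n) := fun T =>
    WithLp.toLp 2 fun i => if i ∈ T then y i else x i
  have hz : ∀ T, z T ∈ Metric.ball x r := by
    intro T
    rw [Metric.mem_ball] at hy ⊢
    refine lt_of_le_of_lt ?_ hy
    rw [EuclideanSpace.dist_eq, EuclideanSpace.dist_eq]
    refine Real.sqrt_le_sqrt (Finset.sum_le_sum fun i _ => ?_)
    by_cases hi : i ∈ T
    · simp [z, hi]
    · simp [z, hi]
  have key : ∀ T, (ronkin f (z T)).toReal =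
      (ronkin f x).toReal + ∑ i ∈ T, (m i : ℝ) * (y i - x i) := by
    intro T
    induction T using Finset.induction_on with
    | empty =>
      have : z ∅ = x := by ext i; simp [z]
      simp [this]
    | insert j T hj ih =>
      have e : z (insert j T) = z T + (y j - x j) • intVec (Pi.single j 1) := by
        ext i
        by_cases hij : i = j
        · subst hij; simp [z, hj, intVec]
        · simp [z, hij, intVec]
      rw [e, ronkin_add_smul_of_slope hf hCS (hm j), ih, Finset.sum_insert hj]
      · ring
      · rw [← e]
        exact ((convex_ball x r).segment_subset (hz _) (hz _)).trans hball
  have := key Finset.univ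
  have e : z Finset.univ = y := by ext i; simp [z]
  rwa [e] at this

theorem hasGradientAt_of_affine {g : EuclideanSpace ℝ (Fin n) → ℝ} {v x : EuclideanSpace ℝ (Fin n)}
    {r : ℝ} (hr : 0 < r)
    (h : ∀ y ∈ Metric.ball x r, g y = g x + ∑ i, v i * (y i - x i)) : HasGradientAt g v x := by
  rw [hasGradientAt_iff_hasFDerivAt]
  have h1 : HasFDerivAt (fun y => g x + (InnerProductSpace.toDual ℝ _ v) (y - x))
      (InnerProductSpace.toDual ℝ (EuclideanSpace ℝ (Fin n)) v) x :=
    (((InnerProductSpace.toDual ℝ (EuclideanSpace ℝ (Fin n)) v).hasFDerivAt).comp x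
      ((hasFDerivAt_id x).sub_const x)).const_add _
  refine h1.congr_of_eventuallyEq ?_
  filter_upwards [Metric.ball_mem_nhds x hr] with y hy
  rw [h y hy, InnerProductSpace.toDual_apply_apply, PiLp.inner_apply]
  simp [mul_comm]

/-! ### Components of the complement -/

theorem isOpen_complementComponent (hf : IsRegular f) {C : Set (EuclideanSpace ℝ (Fin n))}
    (hC : C ∈ complementComponents f) : IsOpen C := by
  obtain ⟨x, -, rfl⟩ := hC
  exact (isOpen_compl_matrixAmoeba hf).connectedComponentIn

theorem isPreconnected_complementComponent {C : Set (EuclideanSpace ℝ (Fin n))}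
    (hC : C ∈ complementComponents f) : IsPreconnected C := by
  obtain ⟨x, -, rfl⟩ := hC
  exact isPreconnected_connectedComponentIn

theorem complementComponent_subset {C : Set (EuclideanSpace ℝ (Fin n))}
    (hC : C ∈ complementComponents f) : C ⊆ (matrixAmoeba f)ᶜ := by
  obtain ⟨x, -, rfl⟩ := hC
  exact connectedComponentIn_subset _ _

theorem eq_connectedComponentIn {C : Set (EuclideanSpace ℝ (Fin n))}
    (hC : C ∈ complementComponents f) {x : EuclideanSpace ℝ (Fin n)} (hx : x ∈ C) :
    C = connectedComponentIn (matrixAmoeba f)ᶜ x := by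
  obtain ⟨y, -, rfl⟩ := hC
  exact connectedComponentIn_eq hx

/-- The slope of the circle means in direction `k` is the pairing of `k` with the gradient. -/
theorem orbitMean_slope_eq_sum (hf : IsRegular f) {C : Set (EuclideanSpace ℝ (Fin n))}
    (hCS : C ⊆ (matrixAmoeba f)ᶜ) {m : Fin n → ℤ} {x : EuclideanSpace ℝ (Fin n)}
    (hx : ∃ r > 0, Metric.ball x r ⊆ C ∧ ∀ y ∈ Metric.ball x r,
      (ronkin f y).toReal = (ronkin f x).toReal + ∑ i, (m i : ℝ) * (y i - x i)) {l : ℤ}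
    (hl : ∀ x ∈ C, ∀ W, ∀ τ ≥ (0 : ℝ),
      (∀ s ∈ Set.Icc 0 τ, x + s • intVec k ∈ (matrixAmoeba f)ᶜ) →
      orbitMean f k (x + τ • intVec k) W - orbitMean f k x W = τ * l) :
    l = ∑ i, m i * k i := by
  obtain ⟨r, hr, hball, hr'⟩ := hx
  obtain ⟨τ, hτ, hev⟩ := exists_pos_forall_add_smul_mem Metric.isOpen_ball
    (Metric.mem_ball_self (x := x) hr) (intVec k)
  have hmem := hev.self_of_nhds τ ⟨hτ.le, le_rfl⟩
  have h1 := ronkin_add_smul_of_slope hf hCS hl (x := x) (τ := τ)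
    (((convex_ball x r).segment_subset (Metric.mem_ball_self hr) hmem).trans hball)
  rw [hr' _ hmem, add_right_inj] at h1
  have h2 : ∑ i, (m i : ℝ) * ((x + τ • intVec k) i - x i) = τ * ∑ i, (m i : ℝ) * k i := by
    rw [Finset.mul_sum]
    refine Finset.sum_congr rfl fun i _ => ?_
    simp [intVec]
    ring
  rw [h2] at h1
  exact_mod_cast (mul_left_cancel₀ hτ.ne' h1).symm

/-- An open set is met by some ray from `x` in an integer direction. -/
theorem exists_intVec_mem {C : Set (EuclideanSpace ℝ (Fin n))} (hC : IsOpen C)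
    (hne : C.Nonempty) (x : EuclideanSpace ℝ (Fin n)) :
    ∃ (k : Fin n → ℤ) (τ : ℝ), 0 < τ ∧ x + τ • intVec k ∈ C := by
  obtain ⟨y, hy⟩ := hne
  have h : Filter.Tendsto (fun D : ℕ => x + (D : ℝ)⁻¹ • intVec fun i => ⌊(y i - x i) * D⌋)
      Filter.atTop (nhds y) := by
    -- round `D * (y - x)` down to an integer vector, coordinate by coordinate
    refine ((PiLp.continuous_toLp 2 fun _ : Fin n => ℝ).tendsto y.ofLp).comp
      (f := fun (D : ℕ) i => x i + (D : ℝ)⁻¹ * ⌊(y i - x i) * D⌋) (tendsto_pi_nhds.2 fun i => ?_)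
    have hinv : Filter.Tendsto (fun D : ℕ => y i - (D : ℝ)⁻¹) Filter.atTop (nhds (y i)) := by
      simpa using (tendsto_inv_atTop_nhds_zero_nat (𝕜 := ℝ)).const_sub (y i)
    refine tendsto_of_tendsto_of_tendsto_of_le_of_le' hinv tendsto_const_nhds ?_ ?_
    · filter_upwards [Filter.eventually_gt_atTop 0] with D hD
      have hD : (0 : ℝ) < D := by exact_mod_cast hD
      have h := mul_le_mul_of_nonneg_left (Int.sub_one_lt_floor ((y i - x i) * D)).le
        (inv_pos.2 hD).le
      have e : (D : ℝ)⁻¹ * ((y i - x i) * D - 1) = y i - x i - (D : ℝ)⁻¹ := by field_simp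
      linarith
    · filter_upwards [Filter.eventually_gt_atTop 0] with D hD
      have hD : (0 : ℝ) < D := by exact_mod_cast hD
      have h := mul_le_mul_of_nonneg_left (Int.floor_le ((y i - x i) * D)) (inv_pos.2 hD).le
      have e : (D : ℝ)⁻¹ * ((y i - x i) * D) = y i - x i := by field_simp
      linarith
  obtain ⟨D, hD, hD'⟩ :=
    ((h.eventually (hC.mem_nhds hy)).and (Filter.eventually_gt_atTop 0)).exists
  exact ⟨_, _, by positivity, hD⟩

/-- Components with the same gradient coincide: along a segment in an integer direction between
them, equality of the slopes at both ends leaves no room for zeros in between. -/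
theorem eq_of_gradient_eq (hf : IsRegular f) {C₁ C₂ : Set (EuclideanSpace ℝ (Fin n))}
    (h₁ : C₁ ∈ complementComponents f) (h₂ : C₂ ∈ complementComponents f) {m : Fin n → ℤ}
    (hm₁ : ∀ x ∈ C₁, ∃ r > 0, Metric.ball x r ⊆ C₁ ∧ ∀ y ∈ Metric.ball x r,
      (ronkin f y).toReal = (ronkin f x).toReal + ∑ i, (m i : ℝ) * (y i - x i))
    (hm₂ : ∀ x ∈ C₂, ∃ r > 0, Metric.ball x r ⊆ C₂ ∧ ∀ y ∈ Metric.ball x r,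
      (ronkin f y).toReal = (ronkin f x).toReal + ∑ i, (m i : ℝ) * (y i - x i)) : C₁ = C₂ := by
  have ho₁ := isOpen_complementComponent hf h₁
  have ho₂ := isOpen_complementComponent hf h₂
  have hs₁ := complementComponent_subset h₁
  have hs₂ := complementComponent_subset h₂
  obtain ⟨x, hx⟩ := complementComponents_nonempty ⟨C₁, h₁⟩
  obtain ⟨k, τ, hτ, hy⟩ := exists_intVec_mem ho₂ (complementComponents_nonempty ⟨C₂, h₂⟩) x
  obtain ⟨l₁, hl₁⟩ := exists_orbitMean_slope hf k ho₁ (isPreconnected_complementComponent h₁) hs₁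
  obtain ⟨l₂, hl₂⟩ := exists_orbitMean_slope hf k ho₂ (isPreconnected_complementComponent h₂) hs₂
  have hl : l₁ = l₂ := by
    rw [orbitMean_slope_eq_sum hf hs₁ (hm₁ x hx) hl₁,
      orbitMean_slope_eq_sum hf hs₂ (hm₂ _ hy) hl₂]
  obtain ⟨τ₁, hτ₁, hev₁⟩ := exists_pos_forall_add_smul_mem ho₁ hx (intVec k)
  obtain ⟨τ₂, hτ₂, hev₂⟩ := exists_pos_forall_add_smul_mem ho₂ hy (intVec k)
  have hev₁ := hev₁.self_of_nhds
  have hev₂ := hev₂.self_of_nhds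
  have hseg : ∀ s ∈ Set.Icc 0 τ, x + s • intVec k ∈ (matrixAmoeba f)ᶜ := by
    intro s hs
    rw [← forall_zeroFreeAt_cocharRestrict]
    intro W
    obtain ⟨ν, hν, hν'⟩ := (hf.isLaurent x W k).exists_slope
    have e₁ : ν 0 = l₁ := by
      have a := hν 0 τ₁ hτ₁.le fun s hs => forall_zeroFreeAt_cocharRestrict.2 (hs₁ (hev₁ s hs)) W
      rw [circleMean_cocharRestrict, circleMean_cocharRestrict, zero_smul, add_zero,
        hl₁ x hx W τ₁ hτ₁.le fun s hs => hs₁ (hev₁ s hs), sub_zero] at a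
      exact_mod_cast (mul_left_cancel₀ hτ₁.ne' a).symm
    have e₂ : ν τ = l₂ := by
      have a := hν τ (τ + τ₂) (by linarith) fun s hs =>
        forall_zeroFreeAt_cocharRestrict.2 (hs₂ (by
          have := hev₂ (s - τ) ⟨by linarith [hs.1], by linarith [hs.2]⟩
          rwa [add_assoc, ← add_smul, add_sub_cancel] at this)) W
      rw [circleMean_cocharRestrict, circleMean_cocharRestrict, add_smul, ← add_assoc,
        hl₂ _ hy W τ₂ hτ₂.le fun s hs => hs₂ (hev₂ s hs), add_sub_cancel_left] at a
      exact_mod_cast (mul_left_cancel₀ hτ₂.ne' a).symm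
    refine hν' 0 τ hτ.le ?_ ?_ (by rw [e₁, e₂, hl]) s hs
    · exact forall_zeroFreeAt_cocharRestrict.2 (by simpa using hs₁ hx) W
    · exact forall_zeroFreeAt_cocharRestrict.2 (hs₂ hy) W
  have hpre : IsPreconnected ((fun s : ℝ => x + s • intVec k) '' Set.Icc 0 τ) :=
    isPreconnected_Icc.image _ (by fun_prop)
  have hsub := hpre.subset_connectedComponentIn (x := x) (F := (matrixAmoeba f)ᶜ)
    ⟨0, ⟨le_rfl, hτ.le⟩, by simp⟩ (by rintro _ ⟨s, hs, rfl⟩; exact hseg s hs)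
  have hmem : x + τ • intVec k ∈ connectedComponentIn (matrixAmoeba f)ᶜ x :=
    hsub ⟨τ, ⟨hτ.le, le_rfl⟩, rfl⟩
  rw [eq_connectedComponentIn h₁ hx, eq_connectedComponentIn h₂ hy]
  exact connectedComponentIn_eq hmem

end

end MatrixAmoeba

end

theorem mainTheorem7 (n : ℕ) (f : GL (Fin n) ℂ → ℂ) (hf : MatrixAmoeba.IsRegular f) :
    (∀ C : MatrixAmoeba.complementComponents f,
      (∃ m : Fin n → ℤ, MatrixAmoeba.orderMap f C = WithLp.toLp 2 fun i => (m i : ℝ)) ∧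
      ∀ x ∈ (C : Set (EuclideanSpace ℝ (Fin n))),
        MatrixAmoeba.ronkin f x ≠ ⊥ ∧ MatrixAmoeba.ronkin f x ≠ ⊤ ∧
        HasGradientAt (fun y => (MatrixAmoeba.ronkin f y).toReal)
          (MatrixAmoeba.orderMap f C) x) ∧
    Function.Injective (MatrixAmoeba.orderMap f) := by
  have haff := fun C : MatrixAmoeba.complementComponents f =>
    MatrixAmoeba.exists_ronkin_affine hf (MatrixAmoeba.isOpen_complementComponent hf C.2)
      (MatrixAmoeba.isPreconnected_complementComponent C.2)
      (MatrixAmoeba.complementComponent_subset C.2)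
  choose m hm using haff
  have hgrad : ∀ (C : MatrixAmoeba.complementComponents f), ∀ x ∈ C.1,
      HasGradientAt (fun y => (MatrixAmoeba.ronkin f y).toReal)
        (WithLp.toLp 2 fun i => (m C i : ℝ)) x := fun C x hx => by
    obtain ⟨r, hr, -, h⟩ := hm C x hx
    exact MatrixAmoeba.hasGradientAt_of_affine hr h
  have hord : ∀ C, MatrixAmoeba.orderMap f C = WithLp.toLp 2 fun i => (m C i : ℝ) := fun C =>
    (hgrad C _ (MatrixAmoeba.complementComponents_nonempty C).some_mem).gradient
  refine ⟨fun C => ⟨⟨m C, hord C⟩, fun x hx => ?_⟩, fun C₁ C₂ h => ?_⟩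
  · rw [hord C, MatrixAmoeba.ronkin_eq_integral_log hf
      (MatrixAmoeba.complementComponent_subset C.2 hx)]
    exact ⟨EReal.coe_ne_bot _, EReal.coe_ne_top _, hgrad C x hx⟩
  · rw [hord, hord] at h
    have hmm : m C₁ = m C₂ := by
      ext i
      have := congrArg (fun v : EuclideanSpace ℝ (Fin n) => v i) h
      simpa using this
    exact Subtype.ext (MatrixAmoeba.eq_of_gradient_eq hf C₁.2 C₂.2 (hm C₁) (hmm ▸ hm C₂))
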